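/- Let $r \ge 2$, let $q$ be a prime power, let $n$ be a composite integer, and let $\ell$ be the smallest prime divisor of $n$. Fix a monomial order on $\mathbb{F}_q[x_1,\dots,x_r]$ and call a polynomial monic if its leading coefficient is $1$. A polynomial over $\mathbb{F}_q$ is called relatively irreducible if it is irreducible over $\mathbb{F}_q$ but not irreducible over an algebraic closure $\overline{\mathbb{F}_q}$. Let $E_{r,n}(\mathbb{F}_q)$ be the set of monic relatively irreducible polynomials in $\mathbb{F}_q[x_1,\dots,x_r]$ of total degree $n$, and put $$\epsilon_{r,n}(q) = \frac{q^{\ell\left(\binom{r+n/\ell}{r}-1\right)}}{\ell\,(1-q^{-\ell})}, \qquad \kappa = (\ell-1)\left(\binom{r-1+n/\ell}{r-1}-r\right)+1.$$ Then $$\left|\#E_{r,n}(\mathbb{F}_q)-\epsilon_{r,n}(q)\right| \le \epsilon_{r,n}(q)\cdot 3q^{-\kappa}.$$ -/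

import Mathlib

/-- The monic irreducible polynomials of total degree `n` in `r` variables over `F`, where
"monic" means leading coefficient one with respect to the monomial order `m`. -/
def monicIrreducible {r : ℕ} (m : MonomialOrder (Fin r)) (n : ℕ) (F : Type*) [Field F] :
    Set (MvPolynomial (Fin r) F) :=
  {f | f.totalDegree = n ∧ m.Monic f ∧ Irreducible f}

/-- A multivariate polynomial over a field `F` is absolutely irreducible if it is irreducible
over an algebraic closure of `F`. -/
def IsAbsolutelyIrreducible {r : ℕ} {F : Type*} [Field F] (f : MvPolynomial (Fin r) F) : Prop :=
  Irreducible (MvPolynomial.map (algebraMap F (AlgebraicClosure F)) f)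

/-- The monic relatively irreducible (exceptional) polynomials of total degree `n` in `r`
variables over `F`: irreducible over `F` but not absolutely irreducible. -/
def relativelyIrreducible {r : ℕ} (m : MonomialOrder (Fin r)) (n : ℕ) (F : Type*) [Field F] :
    Set (MvPolynomial (Fin r) F) :=
  {f | f ∈ monicIrreducible m n F ∧ ¬ IsAbsolutelyIrreducible f}

/-- `ε_{r,n}(q) = q ^ (ℓ (C(r + n/ℓ, r) - 1)) / (ℓ (1 - q ^ (-ℓ)))` with `ℓ` the smallest prime
divisor of `n`. The binomial coefficient is at least one and `ℓ ∣ n`, so the natural-number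
subtraction and division are exact. -/
noncomputable def exceptionalEps (r n q : ℕ) : ℝ :=
  (q : ℝ) ^ (n.minFac * ((r + n / n.minFac).choose r - 1)) /
    ((n.minFac : ℝ) * (1 - ((q : ℝ) ^ n.minFac)⁻¹))

/-- `κ = (ℓ - 1) (C(r - 1 + n/ℓ, r - 1) - r) + 1` with `ℓ` the smallest prime divisor of `n`
(for `r ≥ 1`, as an integer). -/
def exceptionalKappa (r n : ℕ) : ℤ :=
  ((n.minFac : ℤ) - 1) * (((r - 1 + n / n.minFac).choose (r - 1) : ℤ) - (r : ℤ)) + 1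

/-! Let τ be the coefficientwise Frobenius relative to `F`. A monic irreducible f over `F` that is
reducible over the algebraic closure is the product of the distinct conjugates of one monic
irreducible factor. Grouping this orbit modulo a prime divisor p of its length writes f as h · τh ⋯
τ^(p-1)h with h of exact period p (`exists_prime_orbitProd`), so p ∣ n and h is a monic polynomial
of degree n/p over the field of q^p elements. Each f uses up p such h, which bounds the count by a
sum over the primes p ∣ n (`ncard_relativelyIrreducible_le`) whose term p = ℓ is exactly ε.

Conversely, an irreducible g of degree n/ℓ over the field of q^ℓ elements that is not fixed by τ has
ℓ conjugates. Their product is relatively irreducible over `F`, and at most ℓ such g share a product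
(`ncard_irreducible_le`). Discarding the reducible g and those defined over `F` still leaves ε(1 -
3q^(-κ)) (`eps_lower_bound`).

Both errors come down to exponents. With c k = C(r+k, r) - 1, the term of p has order q^(p ·
c(n/p)). Convexity of c and of its difference sequence D k = C(r-1+k, r-1) separates p = ℓ from
every larger prime by at least κ (`weighted_sum_separation`). -/

/-! ### Inequalities for partial sums of convex sequences. -/

section ConvexSequence

variable {c D δ : ℕ → ℤ}

lemma sub_le_mul_of_convex (hD : ∀ k, D (k + 1) = D k + δ k) (hδ : Monotone δ) (k : ℕ) :
    D (k + 1) - D 1 ≤ k * δ (k + 1) := by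
  induction k with
  | zero => simp
  | succ k ih =>
    have h1 := hD (k + 1)
    have h2 := hδ (Nat.le_succ (k + 1))
    push_cast
    simp only [Nat.succ_eq_add_one] at h2
    nlinarith

/-- Trapezoid bound: `c k` sums `D 1, …, D k`, and the mean of a convex sequence is at most the mean
of its two end terms. -/
lemma two_mul_sum_le_of_convex (hc0 : c 0 = 0) (hc : ∀ k, c (k + 1) = c k + D (k + 1))
    (hD : ∀ k, D (k + 1) = D k + δ k) (hδ : Monotone δ) (k : ℕ) :
    2 * c k ≤ k * (D 1 + D k) := by
  rcases k with _ | k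
  · simp [hc0]
  induction k with
  | zero => have := hc 0; simp [hc0] at this ⊢; omega
  | succ k ih =>
    have h1 := hD (k + 1)
    have h2 := hc (k + 1)
    have h3 := sub_le_mul_of_convex hD hδ k
    push_cast at ih ⊢
    nlinarith

lemma sum_lt_mul_next (hc0 : c 0 = 0) (hc : ∀ k, c (k + 1) = c k + D (k + 1))
    (hD : StrictMono D) {k : ℕ} (hk : 1 ≤ k) : c k < k * D (k + 1) := by
  induction k, hk using Nat.le_induction with
  | base => have := hc 0; have h := hD (Nat.lt_succ_self 1); simp [hc0] at this h ⊢; omega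
  | succ k hk ih =>
    have h1 := hc k
    have h2 := hD (Nat.lt_succ_self (k + 1))
    simp only [Nat.succ_eq_add_one] at h2
    push_cast
    nlinarith

/-- Averages of initial segments of an increasing sequence increase; denominators are cleared. -/
lemma mean_le_mean (hc0 : c 0 = 0) (hc : ∀ k, c (k + 1) = c k + D (k + 1))
    (hD : StrictMono D) {e k : ℕ} (he : 1 ≤ e) (hk : e ≤ k) : k * c e ≤ e * c k := by
  induction k, hk using Nat.le_induction with
  | base => exact le_rfl
  | succ k hk ih =>
    have h1 := hc k
    have h2 := sum_lt_mul_next hc0 hc hD he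
    have h3 : (e : ℤ) * D (e + 1) ≤ e * D (k + 1) := by
      have := hD.monotone (by omega : e + 1 ≤ k + 1)
      gcongr
    push_cast
    nlinarith

lemma mean_lt_mean (hc0 : c 0 = 0) (hc : ∀ k, c (k + 1) = c k + D (k + 1))
    (hD : StrictMono D) {e k : ℕ} (he : 1 ≤ e) (hk : e < k) : k * c e < e * c k := by
  obtain ⟨k, rfl⟩ : ∃ j, k = j + 1 := ⟨k - 1, by omega⟩
  have h0 := mean_le_mean hc0 hc hD he (Nat.lt_succ_iff.1 hk)
  have h1 := hc k
  have h2 := sum_lt_mul_next hc0 hc hD he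
  have h3 : (e : ℤ) * D (e + 1) ≤ e * D (k + 1) := by
    have := hD.monotone (by omega : e + 1 ≤ k + 1)
    gcongr
  push_cast
  nlinarith

/-- If `ℓ * d = p * e` with `e < d` then the weighted sums `ℓ * c d` and `p * c e` of a convex
sequence are separated by a multiple of the increment of the sequence. -/
lemma weighted_sum_separation (hc0 : c 0 = 0) (hc : ∀ k, c (k + 1) = c k + D (k + 1))
    (hD : ∀ k, D (k + 1) = D k + δ k) (hδ : Monotone δ) (hδ1 : ∀ k, 1 ≤ δ k)
    {l p d e : ℕ} (hl : 2 ≤ l) (he : 1 ≤ e) (hed : e < d) (hl3 : 3 ≤ l → e + 2 ≤ d)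
    (h : l * d = p * e) : p * c e + ((l - 1) * (D d - D 1) + 1) ≤ l * c d := by
  have hDm : StrictMono D := strictMono_nat_of_lt_succ fun k ↦ by have := hD k; have := hδ1 k; omega
  have hz : (l : ℤ) * d = p * e := by exact_mod_cast h
  have key : ∀ k : ℕ, e ≤ k → (k : ℤ) * (p * c e) ≤ l * d * c k := by
    intro k hk
    have h1 := mean_le_mean hc0 hc hDm he hk
    have h2 : (p : ℤ) * (k * c e) ≤ p * (e * c k) := by gcongr
    rw [hz]
    linarith
  -- Means are compared at k = d - 1 when l = 2 and at k = d - 2 when l ≥ 3; the trapezoid bound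
  -- then pays for replacing k by d. Going back one step costs l / 2 copies of `D k`, which is
  -- affordable only for l = 2, hence the gap `hl3`.
  rcases hl.eq_or_lt with rfl | hl
  · obtain ⟨k, rfl⟩ : ∃ k, d = k + 1 := ⟨d - 1, by omega⟩
    have h1 := key k (by omega)
    have h2 := two_mul_sum_le_of_convex hc0 hc hD hδ k
    have hk : (0 : ℤ) < k := by omega
    have h3 := hD k
    have h4 := hδ1 k
    have h5 := hc k
    refine le_of_mul_le_mul_left ?_ hk
    push_cast at *
    nlinarith
  · obtain ⟨k, rfl⟩ : ∃ k, d = k + 2 := ⟨d - 2, by have := hl3 hl; omega⟩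
    have h1 := key k (by have := hl3 hl; omega)
    have h2 := two_mul_sum_le_of_convex hc0 hc hD hδ k
    have hk : (0 : ℤ) < k := by have := hl3 hl; omega
    have h3 : (p : ℤ) * c e ≤ l * (c k + D 1 + D k) := by
      refine le_of_mul_le_mul_left ?_ hk
      have : (l : ℤ) * (2 * c k) ≤ l * (k * (D 1 + D k)) := by gcongr
      push_cast at *
      nlinarith
    have h4 := hD k
    have h5 := hδ1 k
    have h6 := hc k
    have h7 := hc (k + 1)
    have h8 := hDm.monotone (by omega : 1 ≤ k + 2)
    rw [show k + 2 = k + 1 + 1 from rfl] at *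
    rw [h7, h6]
    have h9 : (l : ℤ) * 1 ≤ l * δ k := by gcongr
    nlinarith

end ConvexSequence

/-! ### Binomial exponents and geometric sums. -/

lemma choose_succ_eq (s k : ℕ) :
    (s + 2 + (k + 1)).choose (s + 2) = (s + 2 + k).choose (s + 2) + (s + 1 + (k + 1)).choose (s + 1) := by
  rw [show s + 2 + (k + 1) = (s + 2 + k) + 1 by ring, Nat.choose_succ_succ' (s + 2 + k) (s + 1), add_comm,
    show s + 1 + (k + 1) = s + 2 + k by ring]

/-- The exponent of the contribution of the extension of degree `p`. -/
lemma exponent_separation {r l p d e : ℕ} (hr : 2 ≤ r) (hl : 2 ≤ l) (he : 1 ≤ e) (hed : e < d)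
    (hl3 : 3 ≤ l → e + 2 ≤ d) (h : l * d = p * e) :
    (p : ℤ) * ((r + e).choose r - 1) + ((l - 1) * ((r - 1 + d).choose (r - 1) - r) + 1) ≤
      l * ((r + d).choose r - 1) := by
  obtain ⟨s, rfl⟩ : ∃ s, r = s + 2 := ⟨r - 2, by omega⟩
  -- By Pascal's rule `D` and `δ` are the first and second differences of `c`. The shift by 1 gives
  -- `c 0 = 0`, and `D 1 = r` is the r subtracted in κ.
  have := weighted_sum_separation (c := fun k ↦ (s + 2 + k).choose (s + 2) - 1)
    (D := fun k ↦ (s + 1 + k).choose (s + 1)) (δ := fun k ↦ (s + 1 + k).choose s)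
    (by simp) (fun k ↦ by simp [choose_succ_eq]; ring)
    (fun k ↦ by
      rw [show s + 1 + (k + 1) = (s + 1 + k) + 1 by ring, Nat.choose_succ_succ']; push_cast; ring)
    (fun a b hab ↦ by simpa using Nat.choose_le_choose s (by omega : s + 1 + a ≤ s + 1 + b))
    (fun k ↦ by have := Nat.choose_pos (show s ≤ s + 1 + k by omega); simp; omega)
    hl he hed hl3 h
  have h1 : ((s + 1 + 1).choose (s + 1) : ℤ) = (s + 2 : ℕ) := by
    rw [Nat.choose_succ_self_right]
  simp only [h1] at this
  exact this

/-- The exponent is n times the mean c e / e, which strictly increases with e. Distinct primes thus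
give distinct powers of q, as `sum_pow_injOn_le` requires. -/
lemma exponent_strict {r n e k : ℕ} (hr : 2 ≤ r) {p p' : ℕ} (he : 1 ≤ e) (hek : e < k)
    (h : n = p * e) (h' : n = p' * k) (hn : 0 < n) :
    p * ((r + e).choose r - 1) < p' * ((r + k).choose r - 1) := by
  obtain ⟨s, rfl⟩ : ∃ s, r = s + 2 := ⟨r - 2, by omega⟩
  have := mean_lt_mean (c := fun k ↦ (s + 2 + k).choose (s + 2) - 1)
    (D := fun k ↦ (s + 1 + k).choose (s + 1))
    (by simp) (fun k ↦ by simp [choose_succ_eq]; ring)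
    (strictMono_nat_of_lt_succ fun k ↦ by
      rw [show s + 1 + (k + 1) = (s + 1 + k) + 1 by ring, Nat.choose_succ_succ']
      have := Nat.choose_pos (show s ≤ s + 1 + k by omega)
      push_cast; omega) he hek
  have c1 := Nat.choose_pos (show s + 2 ≤ s + 2 + e by omega)
  have c2 := Nat.choose_pos (show s + 2 ≤ s + 2 + k by omega)
  zify [Nat.one_le_of_lt c1, Nat.one_le_of_lt c2] at h h' ⊢
  have hek0 : (0 : ℤ) < e * k := by exact_mod_cast Nat.mul_pos he (by omega)
  have hn' : (0 : ℤ) < n := by exact_mod_cast hn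
  refine lt_of_mul_lt_mul_left ?_ hek0.le
  calc _ = (n : ℤ) * (k * (((s + 2 + e).choose (s + 2) : ℕ) - 1)) := by rw [h]; ring
    _ < n * (e * (((s + 2 + k).choose (s + 2) : ℕ) - 1)) := by gcongr
    _ = _ := by rw [h']; ring

/-- Shifting one degree from the larger factor to the smaller loses more monomials than it gains, so
unbalanced factorizations dominate the count of reducibles. -/
lemma choose_add_choose_lt {r d i : ℕ} (hr : 2 ≤ r) (hi : 2 * (i + 1) ≤ d) :
    (r + (i + 1)).choose r + (r + (d - (i + 1))).choose r <
      (r + i).choose r + (r + (d - i)).choose r := by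
  obtain ⟨s, rfl⟩ : ∃ s, r = s + 2 := ⟨r - 2, by omega⟩
  obtain ⟨j, hj⟩ : ∃ j, d - i = j + 1 := ⟨d - i - 1, by omega⟩
  rw [show d - (i + 1) = j by omega, hj, choose_succ_eq, choose_succ_eq]
  have : (s + 1 + (i + 1)).choose (s + 1) < (s + 1 + (j + 1)).choose (s + 1) := by
    have h1 : (s + 1 + (i + 1)).choose (s + 1) < (s + 1 + (i + 1) + 1).choose (s + 1) := by
      rw [Nat.choose_succ_succ']
      have := Nat.choose_pos (show s ≤ s + 1 + (i + 1) by omega)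
      omega
    exact h1.trans_le (Nat.choose_le_choose _ (by omega))
  omega

/-- A sum of distinct powers of `q` with exponents at most `N` is at most `q ^ (N + 1) / (q - 1)`. -/
lemma sum_pow_injOn_le {ι : Type*} (s : Finset ι) (w : ι → ℕ) (hw : Set.InjOn w s) (N : ℕ)
    (hN : ∀ i ∈ s, w i ≤ N) {q : ℝ} (hq : 1 < q) :
    (q - 1) * ∑ i ∈ s, q ^ w i ≤ q ^ (N + 1) := by
  classical
  calc (q - 1) * ∑ i ∈ s, q ^ w i = (q - 1) * ∑ j ∈ s.image w, q ^ j := by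
        rw [Finset.sum_image hw]
    _ ≤ (q - 1) * ∑ j ∈ Finset.range (N + 1), q ^ j := by
        have : 0 ≤ q - 1 := by linarith
        gcongr
        intro j hj
        obtain ⟨i, hi, rfl⟩ := Finset.mem_image.1 hj
        exact Finset.mem_range.2 (Nat.lt_succ_iff.2 (hN i hi))
    _ = q ^ (N + 1) - 1 := by rw [mul_comm, geom_sum_mul]
    _ ≤ _ := by linarith

/-! ### Estimates for ε and κ. -/

section ExceptionalParameters

variable {r n q : ℕ}

/-- With Q = q^ℓ, this shows ε as the leading term of the number of monic polynomials of degree n/ℓ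
over the field of Q elements, divided by the orbit length ℓ. -/
lemma exceptionalEps_eq (hq : 2 ≤ q) (hn : 2 ≤ n) :
    exceptionalEps r n q = ((q : ℝ) ^ n.minFac) ^ ((r + n / n.minFac).choose r) /
      (n.minFac * ((q : ℝ) ^ n.minFac - 1)) := by
  have hl := (Nat.minFac_prime (by omega : n ≠ 1)).two_le
  have hq1 : (1 : ℝ) < (q : ℝ) ^ n.minFac :=
    one_lt_pow₀ (by exact_mod_cast hq) (by omega)
  obtain ⟨b, hb⟩ : ∃ b, (r + n / n.minFac).choose r = b + 1 :=
    ⟨_, (Nat.succ_pred_eq_of_pos (Nat.choose_pos (Nat.le_add_right r _))).symm⟩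
  have hl0 : (n.minFac : ℝ) ≠ 0 := by positivity
  have h1 : (q : ℝ) ^ n.minFac - 1 ≠ 0 := by linarith
  rw [exceptionalEps, hb, Nat.add_sub_cancel, pow_mul]
  field_simp
  ring

lemma le_div_minFac (hn : 2 ≤ n) (hcomp : ¬ n.Prime) : n.minFac ≤ n / n.minFac := by
  rw [Nat.le_div_iff_mul_le (Nat.minFac_pos n), ← sq]
  exact Nat.minFac_sq_le_self (by omega) hcomp

lemma lt_choose_of_two_le {d : ℕ} (hr : 2 ≤ r) (hd : 2 ≤ d) :
    r + 1 ≤ (r - 1 + d).choose (r - 1) := by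
  obtain ⟨s, rfl⟩ : ∃ s, r = s + 2 := ⟨r - 2, by omega⟩
  have h1 : (s + 1 + 2).choose (s + 1) ≤ (s + 1 + d).choose (s + 1) :=
    Nat.choose_le_choose _ (by omega)
  have h2 := Nat.choose_succ_succ' (s + 2) s
  have h3 := Nat.choose_succ_self_right (s + 1)
  have h4 : 1 ≤ (s + 2).choose s := Nat.choose_pos (by omega)
  simp only [show s + 2 - 1 = s + 1 from rfl, show s + 1 + 2 = s + 2 + 1 from rfl,
    show s + 1 + 1 = s + 2 from rfl] at *
  omega

lemma choose_pred_add (hr : 2 ≤ r) {d : ℕ} (hd : 1 ≤ d) :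
    (r + d).choose r = (r + (d - 1)).choose r + (r - 1 + d).choose (r - 1) := by
  obtain ⟨s, rfl⟩ : ∃ s, r = s + 2 := ⟨r - 2, by omega⟩
  obtain ⟨k, rfl⟩ : ∃ k, d = k + 1 := ⟨d - 1, by omega⟩
  exact choose_succ_eq s k

lemma tail_exponent_le (hr : 2 ≤ r) (hn : 2 ≤ n) {p : ℕ} (hp : p.Prime) (hpn : p ∣ n)
    (hpl : p ≠ n.minFac) :
    ((p * ((r + n / p).choose r - 1) : ℕ) : ℤ) + exceptionalKappa r n ≤
      (n.minFac * ((r + n / n.minFac).choose r - 1) : ℕ) := by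
  have hlp := Nat.minFac_prime (by omega : n ≠ 1)
  have hlt : n.minFac < p := lt_of_le_of_ne (Nat.minFac_le_of_dvd hp.two_le hpn) hpl.symm
  have h1 : n.minFac * (n / n.minFac) = n := Nat.mul_div_cancel' (Nat.minFac_dvd n)
  have h2 : p * (n / p) = n := Nat.mul_div_cancel' hpn
  have he : 1 ≤ n / p := Nat.div_pos (Nat.le_of_dvd (by omega) hpn) hp.pos
  have hdvd : n.minFac ∣ n / p := by
    refine (hlp.coprime_iff_not_dvd.2 fun h ↦ ?_).dvd_of_dvd_mul_left ((Nat.minFac_dvd n).trans h2.symm.dvd)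
    exact hpl ((Nat.prime_dvd_prime_iff_eq hlp hp).1 h).symm
  have hle := Nat.le_of_dvd he hdvd
  have h3 := h1.trans h2.symm
  have hed : n / p < n / n.minFac := by
    by_contra! h
    have : n.minFac * (n / n.minFac) ≤ n.minFac * (n / p) := Nat.mul_le_mul_left _ h
    nlinarith
  -- Two odd primes differ by at least 2, so ℓ·d = p·e ≥ ℓ·e + 2e; since ℓ ∣ e, also e ≥ ℓ.
  have hl3 : 3 ≤ n.minFac → n / p + 2 ≤ n / n.minFac := by
    intro h
    have o1 := hlp.eq_two_or_odd
    have o2 := hp.eq_two_or_odd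
    have : n.minFac + 2 ≤ p := by omega
    have h5 : (n.minFac + 2) * (n / p) ≤ p * (n / p) := Nat.mul_le_mul_right _ this
    refine Nat.le_of_mul_le_mul_left ?_ hlp.pos
    nlinarith
  have := exponent_separation hr hlp.two_le he hed hl3 h3
  have c1 : 1 ≤ (r + n / p).choose r := Nat.choose_pos (by omega)
  have c2 : 1 ≤ (r + n / n.minFac).choose r := Nat.choose_pos (by omega)
  rw [exceptionalKappa]
  push_cast [c1, c2]
  linarith

/-- Compositeness gives n/ℓ ≥ 2, so the bracket in κ is at least 1 and absorbs the final + 1. -/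
lemma exceptionalKappa_le (hr : 2 ≤ r) (hn : 2 ≤ n) (hcomp : ¬ n.Prime) :
    exceptionalKappa r n ≤
      n.minFac * (((r - 1 + n / n.minFac).choose (r - 1) : ℕ) - (r : ℤ)) := by
  have hlp := Nat.minFac_prime (by omega : n ≠ 1)
  have h := lt_choose_of_two_le hr (hlp.two_le.trans (le_div_minFac hn hcomp))
  zify at h
  rw [exceptionalKappa]
  linarith

/-- Every prefactor is at most the one for ℓ, called `A`; what remains is a sum of distinct powers
of q with exponents at most `W`, which is κ below the exponent of ε. -/
lemma tail_sum_le (hr : 2 ≤ r) (hn : 2 ≤ n) (hcomp : ¬ n.Prime) (hq : 2 ≤ q) :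
    ∑ p ∈ n.primeFactors.erase n.minFac,
      ((q : ℝ) ^ p) ^ ((r + n / p).choose r) / (p * ((q : ℝ) ^ p - 1)) ≤
    exceptionalEps r n q * (3 * (q : ℝ) ^ (-exceptionalKappa r n)) := by
  set l := n.minFac with hl
  have hlp : l.Prime := Nat.minFac_prime (by omega : n ≠ 1)
  have hq' : (2 : ℝ) ≤ q := by exact_mod_cast hq
  have hq1 : (1 : ℝ) < q := by linarith
  have hQ : (1 : ℝ) < (q : ℝ) ^ l := one_lt_pow₀ hq1 hlp.ne_zero
  set A : ℝ := (q : ℝ) ^ l / (l * ((q : ℝ) ^ l - 1)) with hA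
  have hl0 : (0 : ℝ) < l := by exact_mod_cast hlp.pos
  have hA0 : 0 < A := by
    have : 0 < (q : ℝ) ^ l - 1 := by linarith
    positivity
  obtain ⟨b, hb⟩ : ∃ b, (r + n / l).choose r = b + 1 :=
    ⟨_, (Nat.succ_pred_eq_of_pos (Nat.choose_pos (Nat.le_add_right r _))).symm⟩
  have heps : exceptionalEps r n q = A * (q : ℝ) ^ (l * b) := by
    rw [exceptionalEps_eq hq hn, ← hl, hb, pow_succ, hA, ← pow_mul]
    ring
  obtain ⟨W, hW⟩ : ∃ W : ℕ, (W : ℤ) = (l * b : ℕ) - exceptionalKappa r n := by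
    refine ⟨((l * b : ℕ) - exceptionalKappa r n).toNat, Int.toNat_of_nonneg ?_⟩
    have h1 := exceptionalKappa_le hr hn hcomp
    have h2 := choose_pred_add hr (d := n / l)
      (Nat.div_pos (Nat.minFac_le (by omega)) (Nat.minFac_pos n))
    rw [hb] at h2
    have h3 : (b : ℤ) ≥ ((r - 1 + n / l).choose (r - 1) : ℕ) - r := by omega
    have h4 : (l : ℤ) * (((r - 1 + n / l).choose (r - 1) : ℕ) - r) ≤ l * b := by gcongr
    push_cast
    rw [← hl] at h1
    linarith
  have hterm : ∀ p ∈ n.primeFactors.erase l,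
      ((q : ℝ) ^ p) ^ ((r + n / p).choose r) / (p * ((q : ℝ) ^ p - 1)) ≤
      A * (q : ℝ) ^ (p * ((r + n / p).choose r - 1)) := by
    intro p hp
    obtain ⟨hpl, hp⟩ := Finset.mem_erase.1 hp
    have hlt : l ≤ p := Nat.minFac_le_of_dvd (Nat.prime_of_mem_primeFactors hp).two_le
      (Nat.dvd_of_mem_primeFactors hp)
    obtain ⟨a, ha⟩ : ∃ a, (r + n / p).choose r = a + 1 :=
      ⟨_, (Nat.succ_pred_eq_of_pos (Nat.choose_pos (Nat.le_add_right r _))).symm⟩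
    rw [ha, Nat.add_sub_cancel, pow_succ, ← pow_mul, mul_comm A, mul_div_assoc]
    refine mul_le_mul_of_nonneg_left ?_ (by positivity)
    have hpq : (q : ℝ) ^ l ≤ (q : ℝ) ^ p := pow_le_pow_right₀ hq1.le hlt
    have hp0 : (l : ℝ) ≤ p := by exact_mod_cast hlt
    have e1 : (0 : ℝ) < (q : ℝ) ^ l - 1 := by linarith
    have e2 : (0 : ℝ) < (q : ℝ) ^ p - 1 := by linarith
    have e3 : (0 : ℝ) < p := by linarith
    rw [hA, div_le_div_iff₀ (by positivity) (by positivity)]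
    calc (q : ℝ) ^ p * (l * ((q : ℝ) ^ l - 1)) = l * ((q : ℝ) ^ p * ((q : ℝ) ^ l - 1)) := by ring
      _ ≤ p * ((q : ℝ) ^ l * ((q : ℝ) ^ p - 1)) := by
        apply mul_le_mul hp0 _ _ e3.le
        · linarith
        · positivity
      _ = _ := by ring
  have hsum := sum_pow_injOn_le (n.primeFactors.erase l)
    (fun p ↦ p * ((r + n / p).choose r - 1)) (by
      intro p hp p' hp' h
      by_contra hne
      have key : ∀ p ∈ n.primeFactors, ∀ p' ∈ n.primeFactors, p' < p →
          p * ((r + n / p).choose r - 1) < p' * ((r + n / p').choose r - 1) := by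
        intro p hp p' hp' hlt
        have h1 := Nat.mul_div_cancel' (Nat.dvd_of_mem_primeFactors hp)
        have h2 := Nat.mul_div_cancel' (Nat.dvd_of_mem_primeFactors hp')
        have h3 : 1 ≤ n / p := Nat.div_pos (Nat.le_of_mem_primeFactors hp)
          (Nat.pos_of_mem_primeFactors hp)
        refine exponent_strict hr h3 ?_ h1.symm h2.symm (by omega)
        by_contra! hle
        have : p' * (n / p') ≤ p' * (n / p) := Nat.mul_le_mul_left _ hle
        nlinarith
      have hp := (Finset.mem_erase.1 hp).2
      have hp' := (Finset.mem_erase.1 hp').2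
      rcases lt_or_gt_of_ne hne with hlt | hlt
      · exact (key _ hp' _ hp hlt).ne' h
      · exact (key _ hp _ hp' hlt).ne h) W (by
      intro p hp
      obtain ⟨hpl, hp⟩ := Finset.mem_erase.1 hp
      have := tail_exponent_le hr hn (Nat.prime_of_mem_primeFactors hp)
        (Nat.dvd_of_mem_primeFactors hp) hpl
      rw [← hl, hb, Nat.add_sub_cancel] at this
      zify
      push_cast at this hW ⊢
      linarith) hq1
  set S := ∑ p ∈ n.primeFactors.erase l, (q : ℝ) ^ (p * ((r + n / p).choose r - 1)) with hS
  -- Here q/(q-1) ≤ 2 would suffice; the constant 3 is needed to cover the lower bound.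
  have hS3 : S ≤ 3 * (q : ℝ) ^ W := by
    have h0 : 0 ≤ (q : ℝ) ^ W := by positivity
    rw [pow_succ] at hsum
    have h1 : (q - 1 : ℝ) * S ≤ (q - 1) * (3 * (q : ℝ) ^ W) := by nlinarith
    exact le_of_mul_le_mul_left h1 (by linarith)
  calc _ ≤ ∑ p ∈ n.primeFactors.erase l, A * (q : ℝ) ^ (p * ((r + n / p).choose r - 1)) :=
        Finset.sum_le_sum hterm
    _ = A * S := by rw [Finset.mul_sum]
    _ ≤ A * (3 * (q : ℝ) ^ W) := by gcongr
    _ = _ := by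
      rw [heps, ← zpow_natCast, hW, sub_eq_add_neg, zpow_add₀ (by positivity), zpow_natCast]
      ring

/-- The main term dominates the contribution of the polynomials that are reducible or defined
over the ground field. -/
lemma eps_lower_bound (hr : 2 ≤ r) (hn : 2 ≤ n) (hcomp : ¬ n.Prime) (hq : 2 ≤ q)
    (P : ℕ → ℝ) (P' : ℝ) (hP0 : ∀ i, 0 ≤ P i)
    (hP : ∀ i, 1 ≤ i → ((q : ℝ) ^ n.minFac - 1) * P i + ((q : ℝ) ^ n.minFac) ^ ((r + (i - 1)).choose r) =
      ((q : ℝ) ^ n.minFac) ^ ((r + i).choose r))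
    (hP' : (q - 1) * P' ≤ (q : ℝ) ^ ((r + n / n.minFac).choose r)) (hP'0 : 0 ≤ P') :
    exceptionalEps r n q * (1 - 3 * (q : ℝ) ^ (-exceptionalKappa r n)) ≤
      (P (n / n.minFac) - ∑ i ∈ Finset.Icc 1 (n / n.minFac / 2), P i * P (n / n.minFac - i) - P') /
        n.minFac := by
  have hlp : n.minFac.Prime := Nat.minFac_prime (by omega : n ≠ 1)
  have hld := le_div_minFac hn hcomp
  have hκ := exceptionalKappa_le hr hn hcomp
  have heps := exceptionalEps_eq (r := r) hq hn
  have hκ' : exceptionalKappa r n = ((n.minFac : ℤ) - 1) *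
    (((r - 1 + n / n.minFac).choose (r - 1) : ℤ) - (r : ℤ)) + 1 := rfl
  generalize exceptionalKappa r n = κ at *
  generalize n / n.minFac = d at *
  generalize n.minFac = l at *
  have hl2 := hlp.two_le
  have hq' : (2 : ℝ) ≤ q := by exact_mod_cast hq
  have hq1 : (1 : ℝ) < q := by linarith
  have hQ4 : (4 : ℝ) ≤ (q : ℝ) ^ l := by
    calc (4 : ℝ) = 2 ^ 2 := by norm_num
      _ ≤ (q : ℝ) ^ 2 := by gcongr
      _ ≤ (q : ℝ) ^ l := pow_le_pow_right₀ hq1.le hl2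
  have hl0 : (0 : ℝ) < l := by exact_mod_cast hlp.pos
  have hD := lt_choose_of_two_le hr (hl2.trans hld)
  have hbD := choose_pred_add hr (d := d) (by omega)
  have hb1 : r + 1 ≤ (r + (d - 1)).choose r := by
    calc r + 1 = (r + 1).choose r := by simp
      _ ≤ _ := Nat.choose_le_choose _ (by omega)
  have hbone : (r + 1).choose r = r + 1 := by simp
  set D := (r - 1 + d).choose (r - 1) with hDdef
  set b' := (r + (d - 1)).choose r with hb'
  set b := (r + d).choose r with hb
  zify at hD hbD hb1 hl2 hr
  have hrl : (r : ℤ) * l ≥ 2 * l := by gcongr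
  have hrl' : (l : ℤ) * (D - r) = l * D - r * l := by ring
  have hb'l : (l - 1 : ℤ) * (b' + r) ≥ (l - 1) * 5 := by
    have : (5 : ℤ) ≤ b' + r := by linarith
    have h0 : (0 : ℤ) ≤ l - 1 := by linarith
    gcongr
  have hb'0 : (0 : ℤ) ≤ l * b' := by positivity
  -- `M` is the error unit Q^b q^(-κ). The three losses `t1` (lower degree), `t2` (reducible), `t3`
  -- (defined over the ground field) cost 1/4 + 16/9 + 1/2 < 3 units.
  obtain ⟨N, hN⟩ : ∃ N : ℕ, (N : ℤ) = l * b - κ := by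
    refine ⟨(l * b - κ).toNat, Int.toNat_of_nonneg ?_⟩
    rw [hbD]; linarith
  set M : ℝ := (q : ℝ) ^ N with hM
  have hM0 : 0 < M := by positivity
  set Q : ℝ := (q : ℝ) ^ l with hQ
  have t1 : Q ^ b' ≤ M / 4 := by
    have h1 : l * b' + 2 ≤ N := by zify; rw [hN, hbD]; linarith
    have h2 : (q : ℝ) ^ (l * b' + 2) ≤ M := pow_le_pow_right₀ hq1.le h1
    rw [pow_add, pow_mul] at h2
    have h3 : (4 : ℝ) ≤ (q : ℝ) ^ 2 := by nlinarith
    have h4 : 0 ≤ Q ^ b' := by positivity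
    nlinarith
  have t3 : (Q - 1) * P' ≤ M / 2 := by
    have h1 : l + b + 1 ≤ N := by zify; rw [hN, hκ', hbD]; linarith
    have h2 : (q : ℝ) ^ (l + b + 1) ≤ M := pow_le_pow_right₀ hq1.le h1
    rw [pow_add, pow_add, ← hQ, pow_one] at h2
    have h3 : P' ≤ (q : ℝ) ^ b := by nlinarith
    have h4 : 0 ≤ Q * (q : ℝ) ^ b := by positivity
    nlinarith
  have t2 : (Q - 1) * ∑ i ∈ Finset.Icc 1 (d / 2), P i * P (d - i) ≤ 16 / 9 * M := by
    have hPle : ∀ i, 1 ≤ i → (Q - 1) * P i ≤ Q ^ ((r + i).choose r) := by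
      intro i hi
      have h1 := hP i hi
      have h2 : 0 ≤ Q ^ ((r + (i - 1)).choose r) := by positivity
      linarith
    have hanti : ∀ i, 1 ≤ i → ∀ j, i < j → 2 * j ≤ d →
        (r + j).choose r + (r + (d - j)).choose r < (r + i).choose r + (r + (d - i)).choose r := by
      intro i hi j hij
      induction j, hij using Nat.le_induction with
      | base => exact fun h ↦ choose_add_choose_lt (by omega) h
      | succ j hij ih => exact fun h ↦ (choose_add_choose_lt (by omega) h).trans (ih (by omega))
    -- The exponents strictly decrease for i ≤ d/2, so they are distinct and largest at i = 1, a
    -- linear factor times a cofactor of degree d - 1.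
    have hsum := sum_pow_injOn_le (q := Q) (Finset.Icc 1 (d / 2))
      (fun i ↦ (r + i).choose r + (r + (d - i)).choose r) (by
        intro i hi j hj h
        simp only [Finset.coe_Icc, Set.mem_Icc] at hi hj
        rcases lt_trichotomy i j with hij | hij | hij
        · exact absurd h (hanti i hi.1 j hij (by omega)).ne'
        · exact hij
        · exact absurd h (hanti j hj.1 i hij (by omega)).ne) ((r + 1) + b') (by
        intro i hi
        rw [Finset.mem_Icc] at hi
        rcases hi.1.eq_or_lt with rfl | h
        · simp [hb']
        · have := (hanti 1 le_rfl i h (by omega)).le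
          rwa [hbone] at this) (by linarith)
    have h1 : (Q - 1) * ((Q - 1) * ∑ i ∈ Finset.Icc 1 (d / 2), P i * P (d - i)) ≤
        ∑ i ∈ Finset.Icc 1 (d / 2), Q ^ ((r + i).choose r + (r + (d - i)).choose r) := by
      rw [Finset.mul_sum, Finset.mul_sum]
      refine Finset.sum_le_sum fun i hi ↦ ?_
      rw [Finset.mem_Icc] at hi
      rw [pow_add]
      calc _ = ((Q - 1) * P i) * ((Q - 1) * P (d - i)) := by ring
        _ ≤ _ := mul_le_mul (hPle _ hi.1) (hPle _ (by omega))
          (mul_nonneg (by linarith) (hP0 _)) (by positivity)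
    have h2 : Q ^ (r + b') ≤ M := by
      rw [hQ, ← pow_mul]
      refine pow_le_pow_right₀ hq1.le ?_
      zify
      rw [hN, hbD]
      linarith
    set T := (Q - 1) * ∑ i ∈ Finset.Icc 1 (d / 2), P i * P (d - i)
    have h3 : (Q - 1) * ((Q - 1) * T) ≤ Q ^ 2 * M := by
      calc _ ≤ (Q - 1) * ∑ i ∈ Finset.Icc 1 (d / 2),
            Q ^ ((r + i).choose r + (r + (d - i)).choose r) :=
            mul_le_mul_of_nonneg_left h1 (by linarith)
        _ ≤ Q ^ (r + 1 + b' + 1) := hsum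
        _ = Q ^ 2 * Q ^ (r + b') := by ring
        _ ≤ _ := by gcongr
    have h4 : Q ^ 2 * M ≤ (Q - 1) * ((Q - 1) * (16 / 9 * M)) := by
      -- Q ≥ 4 gives (Q/(Q-1))² ≤ 16/9.
      have : Q ^ 2 ≤ (Q - 1) * (Q - 1) * (16 / 9) := by nlinarith
      calc _ ≤ (Q - 1) * (Q - 1) * (16 / 9) * M := by gcongr
        _ = _ := by ring
    have h5 : 0 < Q - 1 := by linarith
    exact le_of_mul_le_mul_left (le_of_mul_le_mul_left (h3.trans h4) h5) h5
  have hPd := hP d (by omega)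
  have hMe : M = Q ^ b * (q : ℝ) ^ (-κ) := by
    rw [hM, ← zpow_natCast, hN, sub_eq_add_neg, zpow_add₀ (by positivity), hQ, ← pow_mul]
    norm_cast
  rw [heps, div_mul_eq_mul_div, div_le_div_iff₀ (mul_pos hl0 (by linarith)) hl0]
  have : Q ^ b * (1 - 3 * (q : ℝ) ^ (-κ)) ≤
      (P d - ∑ i ∈ Finset.Icc 1 (d / 2), P i * P (d - i) - P') * (Q - 1) := by
    have e : Q ^ b * (1 - 3 * (q : ℝ) ^ (-κ)) = Q ^ b - 3 * M := by rw [hMe]; ring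
    rw [e]
    linarith
  calc _ ≤ (P d - ∑ i ∈ Finset.Icc 1 (d / 2), P i * P (d - i) - P') * (Q - 1) * l := by gcongr
    _ = _ := by ring

end ExceptionalParameters
-- Counting monic polynomials of given total degree.
open MvPolynomial in
/-- The polynomials of total degree `d` that are monic for the monomial order `m`. -/
def monicOfTotalDegree {r : ℕ} (m : MonomialOrder (Fin r)) (d : ℕ) (K : Type*) [Field K] :
    Set (MvPolynomial (Fin r) K) :=
  {f | f.totalDegree = d ∧ m.Monic f}

section Counting

open MvPolynomial

lemma ncard_degree_le {r : ℕ} (hr : 1 ≤ r) (d : ℕ) :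
    {a : Fin r →₀ ℕ | (a.sum fun _ e ↦ e) ≤ d}.ncard = (r + d).choose r ∧
      {a : Fin r →₀ ℕ | (a.sum fun _ e ↦ e) ≤ d}.Finite := by
  have hk (k : ℕ) : {a : Fin r →₀ ℕ | (a.sum fun _ e ↦ e) = k} =
      ((Finset.univ : Finset (Fin r)).finsuppAntidiag k : Set (Fin r →₀ ℕ)) := by
    ext a
    simp [Finset.mem_finsuppAntidiag, Finsupp.sum_fintype]
  obtain ⟨s, rfl⟩ : ∃ s, r = s + 1 := ⟨r - 1, by omega⟩
  induction d with
  | zero =>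
    have := hk 0
    simp only [nonpos_iff_eq_zero]
    rw [this, Set.ncard_coe_finset, Finset.card_finsuppAntidiag_nat_eq_choose]
    simp
  | succ d ih =>
    have hU : {a : Fin (s + 1) →₀ ℕ | (a.sum fun _ e ↦ e) ≤ d + 1} =
        {a | (a.sum fun _ e ↦ e) ≤ d} ∪ {a | (a.sum fun _ e ↦ e) = d + 1} := by
      ext a; simp only [Set.mem_ofPred_eq, Set.mem_union]; omega
    have hfin : {a : Fin (s + 1) →₀ ℕ | (a.sum fun _ e ↦ e) = d + 1}.Finite := by
      rw [hk]; exact Finset.finite_toSet _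
    rw [hU]
    refine ⟨?_, ih.2.union hfin⟩
    rw [Set.ncard_union_eq _ ih.2 hfin, ih.1, hk, Set.ncard_coe_finset,
      Finset.card_finsuppAntidiag_nat_eq_choose, Finset.card_univ, Fintype.card_fin]
    · rw [show s + 1 + (d + 1) - 1 = s + (d + 1) by omega, Nat.choose_symm_add.symm,
        show s + 1 + (d + 1) = s + (d + 1) + 1 by ring, Nat.choose_succ_succ',
        show s + (d + 1) = s + 1 + d by ring, add_comm]
    · rw [Set.disjoint_left]
      intro a h1 h2
      simp only [Set.mem_ofPred_eq] at h1 h2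
      omega

variable {r : ℕ} {K : Type*} [Field K] [Finite K]

lemma ncard_totalDegree_le (hr : 1 ≤ r) (d : ℕ) :
    {f : MvPolynomial (Fin r) K | f.totalDegree ≤ d}.ncard = Nat.card K ^ (r + d).choose r ∧
      {f : MvPolynomial (Fin r) K | f.totalDegree ≤ d}.Finite := by
  have h0 : {f : MvPolynomial (Fin r) K | f.totalDegree ≤ d} =
      (restrictTotalDegree (Fin r) K d : Set (MvPolynomial (Fin r) K)) := by
    ext f; simp [mem_restrictTotalDegree]
  obtain ⟨hc, hf⟩ := ncard_degree_le hr d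
  have := hf.to_subtype
  let B : Module.Basis {a : Fin r →₀ ℕ | (a.sum fun _ e ↦ e) ≤ d} K
    (restrictTotalDegree (Fin r) K d) := basisRestrictSupport K _
  have : Module.Finite K (restrictTotalDegree (Fin r) K d) := .of_basis B
  have hfin : Finite (restrictTotalDegree (Fin r) K d) := Module.finite_of_finite K
  rw [h0]
  refine ⟨?_, Set.toFinite _⟩
  rw [← Nat.card_coe_set_eq]
  refine (Module.natCard_eq_pow_finrank (K := K)
    (V := restrictTotalDegree (Fin r) K d)).trans ?_
  rw [Module.finrank_eq_nat_card_basis B, Nat.card_coe_set_eq, hc]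

lemma finite_monicOfTotalDegree (m : MonomialOrder (Fin r)) (hr : 1 ≤ r) (d : ℕ) :
    (monicOfTotalDegree m d K).Finite :=
  (ncard_totalDegree_le hr d).2.subset fun _ hf ↦ hf.1.le

omit [Finite K] in
lemma totalDegree_C_mul' {u : K} (hu : u ≠ 0) (f : MvPolynomial (Fin r) K) :
    (C u * f).totalDegree = f.totalDegree := by
  rcases eq_or_ne f 0 with rfl | hf
  · simp
  · rw [totalDegree_mul_of_isDomain (by simpa) hf, totalDegree_C, zero_add]

/-- Each polynomial of degree exactly d is uniquely a nonzero scalar times a monic one, so the count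
does not depend on the monomial order. -/
lemma ncard_monicOfTotalDegree (m : MonomialOrder (Fin r)) (hr : 1 ≤ r) {d : ℕ} (hd : 1 ≤ d) :
    (Nat.card K - 1) * (monicOfTotalDegree m d K).ncard + Nat.card K ^ (r + (d - 1)).choose r =
      Nat.card K ^ (r + d).choose r := by
  obtain ⟨h1, f1⟩ := ncard_totalDegree_le (K := K) hr d
  obtain ⟨h2, f2⟩ := ncard_totalDegree_le (K := K) hr (d - 1)
  have hU : {f : MvPolynomial (Fin r) K | f.totalDegree ≤ d} =
      {f | f.totalDegree = d} ∪ {f | f.totalDegree ≤ d - 1} := by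
    ext f; simp only [Set.mem_ofPred_eq, Set.mem_union]; omega
  have f3 : {f : MvPolynomial (Fin r) K | f.totalDegree = d}.Finite := f1.subset fun f hf ↦ hf.le
  rw [← h1, ← h2, hU, Set.ncard_union_eq _ f3 f2]
  · congr 1
    rw [← Nat.card_units, ← Nat.card_coe_set_eq, ← Nat.card_coe_set_eq, ← Nat.card_prod]
    refine Nat.card_congr (Equiv.ofBijective
      (fun x ↦ ⟨C (x.1 : K) * x.2.1, (totalDegree_C_mul' x.1.ne_zero _).trans x.2.2.1⟩) ⟨?_, ?_⟩)
    · rintro ⟨u, f, hf⟩ ⟨v, g, hg⟩ h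
      simp only [Subtype.mk.injEq] at h
      have h' := congrArg m.leadingCoeff h
      rw [m.leadingCoeff_mul, m.leadingCoeff_mul, hf.2.leadingCoeff_eq_one,
        hg.2.leadingCoeff_eq_one, m.leadingCoeff_C, m.leadingCoeff_C, mul_one, mul_one] at h'
      obtain rfl := Units.ext h'
      simpa using h
    · rintro ⟨f, hf⟩
      have hf' : f.totalDegree = d := hf
      have h0 : m.leadingCoeff f ≠ 0 := by
        rw [m.leadingCoeff_ne_zero_iff]
        rintro rfl
        simp at hf'; omega
      refine ⟨⟨Units.mk0 _ h0, C (m.leadingCoeff f)⁻¹ * f,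
        (totalDegree_C_mul' (inv_ne_zero h0) f).trans hf', ?_⟩, ?_⟩
      · rw [MonomialOrder.Monic, m.leadingCoeff_mul, m.leadingCoeff_C, inv_mul_cancel₀ h0]
      · ext1
        simp only [Units.val_mk0]
        rw [← mul_assoc, ← C_mul, mul_inv_cancel₀ h0, C_1, one_mul]
  · rw [Set.disjoint_left]
    intro f h3 h4
    simp only [Set.mem_ofPred_eq] at h3 h4
    omega

end Counting

/-! ### Products over orbits of a ring automorphism. -/

section OrbitProduct

variable {R : Type*} [CommRing R]

/-- The product of the first `k` iterates of `g` under a ring automorphism. -/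
def orbitProd (τ : R ≃+* R) (k : ℕ) (g : R) : R := ∏ i ∈ Finset.range k, τ^[i] g

lemma iterate_map_finset_prod (τ : R ≃+* R) {ι : Type*} (s : Finset ι) (f : ι → R) (m : ℕ) :
    τ^[m] (∏ i ∈ s, f i) = ∏ i ∈ s, τ^[m] (f i) := by
  induction m with
  | zero => rfl
  | succ m ih => simp only [Function.iterate_succ_apply', ih, map_prod]

lemma prod_range_shift (F : ℕ → R) {k : ℕ} (h : F k = F 0) :
    ∏ j ∈ Finset.range k, F (j + 1) = ∏ j ∈ Finset.range k, F j := by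
  rcases k with _ | k
  · rfl
  · rw [Finset.prod_range_succ, h, ← Finset.prod_range_succ']

lemma map_orbitProd (τ : R ≃+* R) {k : ℕ} {g : R} (h : τ^[k] g = g) :
    τ (orbitProd τ k g) = orbitProd τ k g := by
  rw [orbitProd, map_prod]
  simp only [← Function.iterate_succ_apply' τ]
  exact prod_range_shift (fun j ↦ τ^[j] g) h

/-- Sorting the iterates by residue modulo p turns a long orbit product into one of length p. -/
lemma orbitProd_mul_eq (τ : R ≃+* R) (p k : ℕ) (g : R) :
    orbitProd τ (p * k) g = orbitProd τ p (∏ j ∈ Finset.range k, τ^[p * j] g) := by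
  induction k with
  | zero => simp [orbitProd]
  | succ k ih =>
    rw [Finset.prod_range_succ, Nat.mul_succ, orbitProd, Finset.prod_range_add, ← orbitProd, ih]
    simp only [orbitProd, iterate_map_mul, Finset.prod_mul_distrib, ← Function.iterate_add_apply]
    simp only [add_comm]

lemma dvd_orbitProd (τ : R ≃+* R) {k : ℕ} (hk : 0 < k) (g : R) : g ∣ orbitProd τ k g :=
  Finset.dvd_prod_of_mem (fun i ↦ τ^[i] g) (Finset.mem_range.2 hk)

lemma irreducible_iterate {τ : R ≃+* R} {g : R} (hg : Irreducible g) (i : ℕ) :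
    Irreducible (τ^[i] g) := by
  induction i with
  | zero => exact hg
  | succ i ih => rw [Function.iterate_succ_apply']; exact (MulEquiv.irreducible_iff τ).2 ih

/-- The iterates below the period are pairwise non-associated irreducibles, each dividing the
invariant `h`. The hypothesis `hτ` is what monic normalization supplies. -/
lemma orbitProd_dvd [DecompositionMonoid R] {τ : R ≃+* R} {g h : R} (hg : Irreducible g)
    (hτ : ∀ i j, Associated (τ^[i] g) (τ^[j] g) → τ^[i] g = τ^[j] g)
    (hh : τ h = h) (hgh : g ∣ h) : orbitProd τ (Function.minimalPeriod τ g) g ∣ h := by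
  refine Finset.prod_dvd_of_isRelPrime ?_ fun i _ ↦ ?_
  · intro i hi j hj hij
    refine (irreducible_iterate hg i).isRelPrime_iff_not_dvd.2 fun hdvd ↦ hij ?_
    have := hτ i j ((irreducible_iterate hg i).associated_of_dvd (irreducible_iterate hg j) hdvd)
    simp only [Finset.coe_range, Set.mem_Iio] at hi hj
    exact (Function.iterate_eq_iterate_iff_of_lt_minimalPeriod hi hj).1 this
  · induction i with
    | zero => exact hgh
    | succ i ih =>
      rw [Function.iterate_succ_apply', ← hh]
      exact map_dvd τ (ih (Finset.mem_range.2 (by rename_i hi; have := Finset.mem_range.1 hi; omega)))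

end OrbitProduct

/-! ### Monic polynomials under field maps. -/

section MonicPolynomials

open MvPolynomial

variable {r : ℕ} {F K : Type*} [Field F] [Field K] {m : MonomialOrder (Fin r)}

lemma MonomialOrder.degree_map (φ : F →+* K) (f : MvPolynomial (Fin r) F) :
    m.degree (map φ f) = m.degree f := by
  rw [MonomialOrder.degree, support_map_of_injective _ φ.injective, ← MonomialOrder.degree]

lemma MonomialOrder.monic_map_iff (φ : F →+* K) {f : MvPolynomial (Fin r) F} :
    m.Monic (map φ f) ↔ m.Monic f := by
  rw [MonomialOrder.Monic, MonomialOrder.Monic, MonomialOrder.leadingCoeff, m.degree_map,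
    coeff_map, ← MonomialOrder.leadingCoeff, map_eq_one_iff φ φ.injective]

lemma totalDegree_map_field (φ : F →+* K) (f : MvPolynomial (Fin r) F) :
    (map φ f).totalDegree = f.totalDegree := by
  rw [totalDegree, totalDegree, support_map_of_injective _ φ.injective]

lemma isUnit_iff_totalDegree_eq_zero {f : MvPolynomial (Fin r) F} :
    IsUnit f ↔ f ≠ 0 ∧ f.totalDegree = 0 := by
  constructor
  · intro h
    exact ⟨h.ne_zero, (isUnit_iff_totalDegree_of_isReduced.1 h).2⟩
  · rintro ⟨h0, h⟩
    obtain h := totalDegree_eq_zero_iff_eq_C.1 h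
    rw [h]
    refine IsUnit.map C (isUnit_iff_ne_zero.2 fun hc ↦ h0 ?_)
    rw [h, hc, C_0]

lemma isUnit_mvMap_iff (φ : F →+* K) {f : MvPolynomial (Fin r) F} :
    IsUnit (map φ f) ↔ IsUnit f := by
  rw [isUnit_iff_totalDegree_eq_zero, isUnit_iff_totalDegree_eq_zero, totalDegree_map_field,
    map_ne_zero_iff _ (map_injective φ φ.injective)]

lemma MonomialOrder.Monic.eq_of_associated {f g : MvPolynomial (Fin r) F} (hf : m.Monic f)
    (hg : m.Monic g) (h : Associated f g) : f = g := by
  obtain ⟨u, rfl⟩ := h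
  obtain ⟨c, -, hc⟩ := isUnit_iff_eq_C_of_isReduced.1 u.isUnit
  have := hg.leadingCoeff_eq_one
  rw [m.leadingCoeff_mul, hf.leadingCoeff_eq_one, one_mul, hc, m.leadingCoeff_C] at this
  rw [hc, this, C_1, mul_one]

lemma exists_monic_associated {f : MvPolynomial (Fin r) F} (hf : f ≠ 0) :
    ∃ g, m.Monic g ∧ Associated f g := by
  have h0 : m.leadingCoeff f ≠ 0 := m.leadingCoeff_ne_zero_iff.2 hf
  refine ⟨f * C (m.leadingCoeff f)⁻¹, ?_, ?_⟩
  · rw [MonomialOrder.Monic, m.leadingCoeff_mul, m.leadingCoeff_C, mul_inv_cancel₀ h0]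
  · exact associated_mul_unit_right _ _ (IsUnit.map C (isUnit_iff_ne_zero.2 (inv_ne_zero h0)))

lemma totalDegree_prod_field {ι : Type*} (s : Finset ι) (f : ι → MvPolynomial (Fin r) F)
    (hf : ∀ i ∈ s, f i ≠ 0) : (∏ i ∈ s, f i).totalDegree = ∑ i ∈ s, (f i).totalDegree := by
  classical
  induction s using Finset.induction_on with
  | empty => simp
  | insert a s ha ih =>
    have hs : ∀ i ∈ s, f i ≠ 0 := fun i hi ↦ hf i (Finset.mem_insert_of_mem hi)
    rw [Finset.prod_insert ha, Finset.sum_insert ha,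
      totalDegree_mul_of_isDomain (hf a (Finset.mem_insert_self a s)) (Finset.prod_ne_zero_iff.2 hs),
      ih hs]

lemma monic_iterate (σ : K ≃+* K) {g : MvPolynomial (Fin r) K} (hg : m.Monic g) (i : ℕ) :
    m.Monic ((mapEquiv (Fin r) σ)^[i] g) := by
  induction i with
  | zero => exact hg
  | succ i ih =>
    rw [Function.iterate_succ_apply', mapEquiv_apply]
    exact (MonomialOrder.monic_map_iff (σ : K →+* K)).2 ih

lemma totalDegree_iterate (σ : K ≃+* K) (g : MvPolynomial (Fin r) K) (i : ℕ) :
    ((mapEquiv (Fin r) σ)^[i] g).totalDegree = g.totalDegree := by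
  induction i with
  | zero => rfl
  | succ i ih =>
    rw [Function.iterate_succ_apply', mapEquiv_apply, ← ih]
    exact totalDegree_map_field (σ : K →+* K) _

lemma coeff_iterate (σ : K ≃+* K) (g : MvPolynomial (Fin r) K) (i : ℕ) (a : Fin r →₀ ℕ) :
    coeff a ((mapEquiv (Fin r) σ)^[i] g) = σ^[i] (coeff a g) := by
  induction i with
  | zero => rfl
  | succ i ih =>
    rw [Function.iterate_succ_apply', Function.iterate_succ_apply', mapEquiv_apply, ← ih, coeff_map]
    rfl

lemma monic_orbitProd (σ : K ≃+* K) {g : MvPolynomial (Fin r) K} (hg : m.Monic g) (k : ℕ) :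
    m.Monic (orbitProd (mapEquiv (Fin r) σ) k g) :=
  MonomialOrder.Monic.prod fun i _ ↦ monic_iterate σ hg i

lemma totalDegree_orbitProd (σ : K ≃+* K) {g : MvPolynomial (Fin r) K} (hg : m.Monic g) (k : ℕ) :
    (orbitProd (mapEquiv (Fin r) σ) k g).totalDegree = k * g.totalDegree := by
  rw [orbitProd, totalDegree_prod_field _ _ fun i _ ↦ (monic_iterate σ hg i).ne_zero]
  simp [totalDegree_iterate]

lemma mem_range_map_iff_coeff (φ : F →+* K) {g : MvPolynomial (Fin r) K} :
    (∃ f, map φ f = g) ↔ ∀ a, ∃ c, φ c = coeff a g := by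
  constructor
  · rintro ⟨f, rfl⟩ a
    exact ⟨coeff a f, (coeff_map φ f a).symm⟩
  · intro h
    refine (mem_range_map_iff_coeffs_subset (f := φ)).2 fun c hc ↦ ?_
    obtain ⟨a, -, rfl⟩ := mem_coeffs_iff.1 hc
    exact h a

end MonicPolynomials

/-! ### Descent to the fixed field. -/

section Descent

open MvPolynomial

variable {r : ℕ} {F K : Type*} [Field F] [Field K] [Algebra F K] {m : MonomialOrder (Fin r)}
  {σ : K ≃ₐ[F] K}

lemma mapEquiv_map_algebraMap (f : MvPolynomial (Fin r) F) :
    mapEquiv (Fin r) σ.toRingEquiv (map (algebraMap F K) f) = map (algebraMap F K) f := by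
  ext a
  simp [coeff_map]

lemma exists_map_eq_of_fixed (hσ : ∀ x, σ x = x → ∃ y, algebraMap F K y = x)
    {g : MvPolynomial (Fin r) K} (hg : mapEquiv (Fin r) σ.toRingEquiv g = g) :
    ∃ f, map (algebraMap F K) f = g := by
  refine (mem_range_map_iff_coeff _).2 fun a ↦ hσ _ ?_
  conv_rhs => rw [← hg]
  rw [mapEquiv_apply, coeff_map]
  rfl

lemma orbitProd_dvd_of_monic {g h : MvPolynomial (Fin r) K} (hg : Irreducible g) (hgm : m.Monic g)
    (hh : mapEquiv (Fin r) σ.toRingEquiv h = h) (hgh : g ∣ h) :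
    orbitProd (mapEquiv (Fin r) σ.toRingEquiv)
      (Function.minimalPeriod (mapEquiv (Fin r) σ.toRingEquiv) g) g ∣ h :=
  orbitProd_dvd hg (fun i j ↦ (monic_iterate _ hgm i).eq_of_associated (monic_iterate _ hgm j)) hh hgh

/-- An irreducible polynomial over the fixed field is the orbit product of any of its irreducible
factors. -/
lemma map_eq_orbitProd (hσ : ∀ x, σ x = x → ∃ y, algebraMap F K y = x)
    {f : MvPolynomial (Fin r) F} (hf : Irreducible f) (hfm : m.Monic f)
    {g : MvPolynomial (Fin r) K} (hg : Irreducible g) (hgm : m.Monic g)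
    (hgf : g ∣ map (algebraMap F K) f)
    (hk : 0 < Function.minimalPeriod (mapEquiv (Fin r) σ.toRingEquiv) g) :
    map (algebraMap F K) f = orbitProd (mapEquiv (Fin r) σ.toRingEquiv)
      (Function.minimalPeriod (mapEquiv (Fin r) σ.toRingEquiv) g) g := by
  have hinj := map_injective (σ := Fin r) (algebraMap F K) (algebraMap F K).injective
  set τ := mapEquiv (Fin r) σ.toRingEquiv
  set k := Function.minimalPeriod τ g
  have hfix : τ (orbitProd τ k g) = orbitProd τ k g :=
    map_orbitProd τ Function.iterate_minimalPeriod
  have hNm : m.Monic (orbitProd τ k g) := monic_orbitProd _ hgm k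
  obtain ⟨c, hc⟩ := orbitProd_dvd_of_monic (σ := σ) hg hgm (mapEquiv_map_algebraMap f) hgf
  obtain ⟨f₀, hf₀⟩ := exists_map_eq_of_fixed hσ hfix
  -- The cofactor is invariant too, so the factorization descends to `F`, where irreducibility makes
  -- the cofactor a unit.
  have hcfix : τ c = c := by
    have h1 : τ (map (algebraMap F K) f) = map (algebraMap F K) f := mapEquiv_map_algebraMap f
    rw [hc, map_mul] at h1
    change τ (orbitProd τ k g) * τ c = orbitProd τ k g * c at h1
    rw [hfix] at h1
    exact mul_left_cancel₀ hNm.ne_zero h1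
  obtain ⟨c₀, rfl⟩ := exists_map_eq_of_fixed hσ hcfix
  change _ = orbitProd τ k g * _ at hc
  rw [← hf₀, ← map_mul] at hc
  obtain rfl := hinj hc
  have hnu : ¬ IsUnit f₀ := by
    rw [← isUnit_mvMap_iff (algebraMap F K), hf₀]
    exact fun h ↦ hg.not_isUnit (isUnit_of_dvd_unit (dvd_orbitProd τ hk g) h)
  have hu : IsUnit c₀ := (hf.isUnit_or_isUnit rfl).resolve_left hnu
  have hf₀m : m.Monic f₀ := (MonomialOrder.monic_map_iff (algebraMap F K)).1 (hf₀ ▸ hNm)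
  rw [← hf₀m.eq_of_associated hfm (associated_mul_unit_right _ _ hu), hf₀]

/-- The orbit product of a monic irreducible polynomial comes from a monic irreducible polynomial
over the fixed field. -/
lemma exists_irreducible_map_eq_orbitProd (hσ : ∀ x, σ x = x → ∃ y, algebraMap F K y = x)
    {g : MvPolynomial (Fin r) K} (hg : Irreducible g) (hgm : m.Monic g)
    (hk : 0 < Function.minimalPeriod (mapEquiv (Fin r) σ.toRingEquiv) g) :
    ∃ f : MvPolynomial (Fin r) F, m.Monic f ∧ Irreducible f ∧
      map (algebraMap F K) f = orbitProd (mapEquiv (Fin r) σ.toRingEquiv)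
        (Function.minimalPeriod (mapEquiv (Fin r) σ.toRingEquiv) g) g := by
  set τ := mapEquiv (Fin r) σ.toRingEquiv
  set k := Function.minimalPeriod τ g
  have hfix : τ (orbitProd τ k g) = orbitProd τ k g :=
    map_orbitProd τ Function.iterate_minimalPeriod
  have hNm : m.Monic (orbitProd τ k g) := monic_orbitProd _ hgm k
  obtain ⟨f, hf⟩ := exists_map_eq_of_fixed hσ hfix
  have hfm : m.Monic f := (MonomialOrder.monic_map_iff (algebraMap F K)).1 (hf ▸ hNm)
  have hgf := dvd_orbitProd τ hk g
  -- A factor divisible by `g` is divisible by the whole orbit product, hence by all of `f`.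
  have key : ∀ a b : MvPolynomial (Fin r) F, f = a * b → g ∣ map (algebraMap F K) a → IsUnit b := by
    intro a b hab hga
    obtain ⟨c, hc⟩ := orbitProd_dvd_of_monic (σ := σ) hg hgm (mapEquiv_map_algebraMap a) hga
    change _ = orbitProd τ k g * _ at hc
    rw [← isUnit_mvMap_iff (algebraMap F K)]
    rw [← hf, hab, map_mul] at hc
    have h0 : map (algebraMap F K) a ≠ 0 := by
      intro h0
      have := hfm.ne_zero
      rw [hab, (map_eq_zero_iff _ (map_injective _ (algebraMap F K).injective)).1 h0, zero_mul] at this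
      exact this rfl
    refine IsUnit.of_mul_eq_one c (mul_left_cancel₀ h0 ?_)
    rw [mul_one, ← mul_assoc, ← hc]
  refine ⟨f, hfm, ⟨?_, ?_⟩, hf⟩
  · rw [← isUnit_mvMap_iff (algebraMap F K), hf]
    exact fun h ↦ hg.not_isUnit (isUnit_of_dvd_unit hgf h)
  · intro a b hab
    rw [← hf, hab, map_mul] at hgf
    rcases hg.prime.dvd_or_dvd hgf with h | h
    · exact Or.inr (key a b hab h)
    · exact Or.inl (key b a (hab.trans (mul_comm a b)) h)

/-- An irreducible polynomial that becomes reducible over an extension is an orbit product of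
prime length. -/
lemma exists_prime_orbitProd (hσ : ∀ x, σ x = x → ∃ y, algebraMap F K y = x)
    (hper : ∀ g : MvPolynomial (Fin r) K, 0 < Function.minimalPeriod (mapEquiv (Fin r) σ.toRingEquiv) g)
    {f : MvPolynomial (Fin r) F} (hf : Irreducible f) (hfm : m.Monic f)
    (hred : ¬ Irreducible (map (algebraMap F K) f)) :
    ∃ (p : ℕ) (h : MvPolynomial (Fin r) K), p.Prime ∧ m.Monic h ∧
      Function.minimalPeriod (mapEquiv (Fin r) σ.toRingEquiv) h = p ∧
      map (algebraMap F K) f = orbitProd (mapEquiv (Fin r) σ.toRingEquiv) p h := by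
  have hinj := map_injective (σ := Fin r) (algebraMap F K) (algebraMap F K).injective
  obtain ⟨g₀, hg₀, hg₀f⟩ := WfDvdMonoid.exists_irreducible_factor
    (mt (isUnit_mvMap_iff (algebraMap F K)).1 hf.not_isUnit)
    ((map_ne_zero_iff _ hinj).2 hf.ne_zero)
  obtain ⟨g, hgm, hg⟩ := exists_monic_associated (m := m) hg₀.ne_zero
  have hgi : Irreducible g := hg.irreducible hg₀
  have hgf : g ∣ map (algebraMap F K) f := hg.symm.dvd.trans hg₀f
  have heq := map_eq_orbitProd hσ hf hfm hgi hgm hgf (hper g)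
  set τ := mapEquiv (Fin r) σ.toRingEquiv
  set k := Function.minimalPeriod τ g with hkdef
  have hk1 : k ≠ 1 := by
    intro h1
    rw [heq, h1] at hred
    exact hred (by simpa [orbitProd] using hgi)
  have hp := Nat.minFac_prime hk1
  have hpk : k.minFac * (k / k.minFac) = k := Nat.mul_div_cancel' (Nat.minFac_dvd k)
  set p := k.minFac
  set h := ∏ j ∈ Finset.range (k / p), τ^[p * j] g with hh
  have hfp : map (algebraMap F K) f = orbitProd τ p h := by
    rw [heq, hh, ← orbitProd_mul_eq, hpk]
  have hhm : m.Monic h := MonomialOrder.Monic.prod fun j _ ↦ monic_iterate _ hgm _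
  refine ⟨p, h, hp, hhm, ?_, hfp⟩
  have hτp : Function.IsPeriodicPt τ p h := by
    change τ^[p] h = h
    rw [hh, iterate_map_finset_prod]
    simp only [← Function.iterate_add_apply]
    have := prod_range_shift (fun j ↦ τ^[p * j] g) (k := k / p) (by
      simp only [mul_zero, Function.iterate_zero, id, hpk]
      exact Function.iterate_minimalPeriod)
    rw [← this]
    simp only [Nat.mul_succ, add_comm]
  rcases (Nat.dvd_prime hp).1 hτp.minimalPeriod_dvd with h1 | h1
  -- Period 1 would make `f` a p-th power over `F`.
  · exfalso
    have hfix : τ h = h := Function.minimalPeriod_eq_one_iff_isFixedPt.1 h1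
    obtain ⟨h₀, hh₀⟩ := exists_map_eq_of_fixed hσ hfix
    have hit (i : ℕ) : τ^[i] h = h := Function.iterate_fixed hfix i
    have hpow : f = h₀ ^ p := by
      apply hinj
      rw [map_pow, hh₀, hfp, orbitProd]
      simp [hit]
    rw [hpow] at hf
    exact not_irreducible_pow hp.ne_one hf
  · exact h1

end Descent

/-! ### Finite fields and the Frobenius. -/

section FiniteFields

open MvPolynomial

/-- X^|K| - X already splits in `K`, so it acquires no new roots in `L`. -/
lemma exists_map_eq_of_pow_card_eq {K L : Type*} [Field K] [Finite K] [Field L] (j : K →+* L)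
    {x : L} (h : x ^ Nat.card K = x) : ∃ y, j y = x := by
  have := Fintype.ofFinite K
  rw [Nat.card_eq_fintype_card] at h
  set P : Polynomial K := Polynomial.X ^ Fintype.card K - Polynomial.X
  have hP0 : P ≠ 0 := FiniteField.X_pow_card_sub_X_ne_zero K Fintype.one_lt_card
  have hroots : P.roots = Finset.univ.val := FiniteField.roots_X_pow_card_sub_X K
  have hsplit : P.Splits := Polynomial.splits_iff_card_roots.2 (by
    rw [hroots, FiniteField.X_pow_card_sub_X_natDegree_eq K Fintype.one_lt_card]
    rfl)
  have hx : x ∈ (P.map j).roots := by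
    rw [Polynomial.mem_roots ((Polynomial.map_ne_zero_iff j.injective).2 hP0)]
    simp [P, h]
  rw [hsplit.roots_map, Multiset.mem_map] at hx
  obtain ⟨y, -, hy⟩ := hx
  exact ⟨y, hy⟩

lemma exists_finite_extension (F : Type*) [Field F] [Finite F] {k : ℕ} (hk : 0 < k) :
    ∃ (K : Type) (_ : Field K) (_ : Finite K) (_ : Algebra F K), Nat.card K = Nat.card F ^ k := by
  obtain ⟨p, hp⟩ := CharP.exists F
  have : Fact p.Prime := ⟨CharP.char_is_prime F p⟩
  have : NeZero k := ⟨hk.ne'⟩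
  exact ⟨FiniteField.Extension F p k, inferInstance, inferInstance, inferInstance,
    FiniteField.natCard_extension F p k⟩

variable {F : Type*} [Field F] [Fintype F]

/-- The coefficientwise Frobenius automorphism relative to `F`. -/
noncomputable abbrev polyFrobenius (r : ℕ) (F K : Type*) [Field F] [Fintype F] [Field K] [Algebra F K]
    [Algebra.IsAlgebraic F K] : MvPolynomial (Fin r) K ≃+* MvPolynomial (Fin r) K :=
  mapEquiv (Fin r) (FiniteField.frobeniusAlgEquivOfAlgebraic F K).toRingEquiv

section

variable {r : ℕ} {K : Type*} [Field K] [Algebra F K] [Algebra.IsAlgebraic F K]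

lemma frobenius_fixed (x : K) (h : FiniteField.frobeniusAlgEquivOfAlgebraic F K x = x) :
    ∃ y, algebraMap F K y = x := by
  refine exists_map_eq_of_pow_card_eq (algebraMap F K) ?_
  rw [Nat.card_eq_fintype_card]
  exact h

lemma coeff_polyFrobenius_iterate (g : MvPolynomial (Fin r) K) (i : ℕ) (a : Fin r →₀ ℕ) :
    coeff a ((polyFrobenius r F K)^[i] g) = coeff a g ^ Fintype.card F ^ i := by
  rw [coeff_iterate]
  exact congrFun (FiniteField.coe_frobeniusAlgEquivOfAlgebraic_iterate F K i) _

/-- The element lies in the finite field F(x), on which the [F(x):F]-th Frobenius iterate is the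
identity. -/
lemma minimalPeriod_frobenius_pos (x : K) :
    0 < Function.minimalPeriod (FiniteField.frobeniusAlgEquivOfAlgebraic F K) x := by
  have hx : IsIntegral F x := (Algebra.IsAlgebraic.isAlgebraic x).isIntegral
  have := IntermediateField.adjoin.finiteDimensional hx
  let L := IntermediateField.adjoin F {x}
  have : Finite L := Module.finite_of_finite F
  have := Fintype.ofFinite L
  refine Function.IsPeriodicPt.minimalPeriod_pos (n := Module.finrank F L) Module.finrank_pos ?_
  rw [Function.IsPeriodicPt, Function.IsFixedPt, FiniteField.coe_frobeniusAlgEquivOfAlgebraic_iterate,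
    ← Module.card_eq_pow_finrank (K := F) (V := L)]
  have h := FiniteField.pow_card (⟨x, IntermediateField.mem_adjoin_simple_self F x⟩ : L)
  exact congrArg Subtype.val h

lemma minimalPeriod_polyFrobenius_pos (g : MvPolynomial (Fin r) K) :
    0 < Function.minimalPeriod (polyFrobenius r F K) g := by
  set σ := FiniteField.frobeniusAlgEquivOfAlgebraic F K
  refine Function.IsPeriodicPt.minimalPeriod_pos
    (n := ∏ a ∈ g.support, Function.minimalPeriod σ (coeff a g))
    (Finset.prod_pos fun a _ ↦ minimalPeriod_frobenius_pos _) ?_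
  ext a
  rw [coeff_iterate]
  change Function.IsPeriodicPt σ _ _
  by_cases ha : a ∈ g.support
  · exact (Function.isPeriodicPt_minimalPeriod σ _).trans_dvd (Finset.dvd_prod_of_mem _ ha)
  · rw [notMem_support_iff.1 ha]
    exact Function.IsFixedPt.isPeriodicPt (map_zero σ) _

end

end FiniteFields

/-! ### Upper bound. -/

section UpperBound

open MvPolynomial

variable {r n : ℕ} {F : Type*} [Field F] [Fintype F] {m : MonomialOrder (Fin r)}

lemma finite_relativelyIrreducible (hr : 1 ≤ r) : (relativelyIrreducible m n F).Finite :=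
  (ncard_totalDegree_le hr n).2.subset fun _ hf ↦ hf.1.1.le

lemma iterate_orbitProd {R : Type*} [CommRing R] (τ : R ≃+* R) (k i : ℕ) (g : R) :
    τ^[i] (orbitProd τ k g) = orbitProd τ k (τ^[i] g) := by
  rw [orbitProd, iterate_map_finset_prod, orbitProd]
  simp only [← Function.iterate_add_apply, add_comm]

/-- The relatively irreducible polynomials that are orbit products of length `p` over the
algebraic closure. -/
def splitRelativelyIrreducible (m : MonomialOrder (Fin r)) (n p : ℕ) (F : Type*) [Field F]
    [Fintype F] : Set (MvPolynomial (Fin r) F) :=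
  {f | f.totalDegree = n ∧ ∃ h, m.Monic h ∧
    Function.minimalPeriod (polyFrobenius r F (AlgebraicClosure F)) h = p ∧
    map (algebraMap F (AlgebraicClosure F)) f = orbitProd (polyFrobenius r F (AlgebraicClosure F)) p h}

lemma relativelyIrreducible_subset (hn : n ≠ 0) :
    relativelyIrreducible m n F ⊆ ⋃ p ∈ n.primeFactors, splitRelativelyIrreducible m n p F := by
  rintro f ⟨⟨hfn, hfm, hf⟩, hred⟩
  obtain ⟨p, h, hp, hm, hper, heq⟩ := exists_prime_orbitProd (m := m)
    (frobenius_fixed (F := F) (K := AlgebraicClosure F)) minimalPeriod_polyFrobenius_pos hf hfm hred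
  have hd := congrArg totalDegree heq
  rw [totalDegree_map_field, hfn, totalDegree_orbitProd _ hm] at hd
  exact Set.mem_biUnion (Nat.mem_primeFactors.2 ⟨hp, ⟨_, hd⟩, hn⟩) ⟨hfn, h, hm, hper, heq⟩

/-- The p conjugates of `h` are distinct and fixed by the p-th Frobenius iterate, so they come from
`K`. Different `f` share none, because the orbit product of any conjugate recovers `f`. -/
lemma mul_ncard_splitRelativelyIrreducible_le (hr : 1 ≤ r) {p : ℕ} (hp : 0 < p)
    {K : Type*} [Field K] [Finite K] [Algebra F K] (hK : Nat.card K = Nat.card F ^ p) :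
    p * (splitRelativelyIrreducible m n p F).ncard ≤ (monicOfTotalDegree m (n / p) K).ncard := by
  let Ω := AlgebraicClosure F
  let τ := polyFrobenius r F Ω
  have : Module.Finite F K := Module.Finite.of_finite
  let j : K →ₐ[F] Ω := IsAlgClosed.lift
  have hinj := map_injective (σ := Fin r) (algebraMap F Ω) (algebraMap F Ω).injective
  choose h hh using fun f : splitRelativelyIrreducible m n p F ↦ f.2.2
  have hfin := (finite_monicOfTotalDegree (K := K) m hr (n / p)).image (map (j : K →+* Ω))
  have := hfin.to_subtype
  refine le_trans ?_ (Set.ncard_image_le (finite_monicOfTotalDegree (K := K) m hr (n / p))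
    (f := map (j : K →+* Ω)))
  rw [← Nat.card_coe_set_eq, ← Nat.card_coe_set_eq, ← Nat.card_fin p, ← Nat.card_prod, Nat.card_fin]
  refine Nat.card_le_card_of_injective (fun x : Fin p × _ ↦ ⟨τ^[x.1] (h x.2), ?_⟩) ?_
  · have hm := monic_iterate (FiniteField.frobeniusAlgEquivOfAlgebraic F Ω).toRingEquiv (hh x.2).1 x.1
    have hd : (τ^[x.1] (h x.2)).totalDegree = n / p := by
      have hd := congrArg totalDegree (hh x.2).2.2
      rw [totalDegree_map_field, x.2.2.1, totalDegree_orbitProd _ (hh x.2).1] at hd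
      rw [totalDegree_iterate]
      exact (Nat.div_eq_of_eq_mul_right hp hd).symm
    have hper : τ^[p] (τ^[x.1] (h x.2)) = τ^[x.1] (h x.2) := by
      rw [← Function.iterate_add_apply, add_comm, Function.iterate_add_apply]
      congr 1
      have := Function.iterate_minimalPeriod (f := τ) (x := h x.2)
      rwa [(hh x.2).2.1] at this
    obtain ⟨g, hg⟩ := (mem_range_map_iff_coeff (j : K →+* Ω) (g := τ^[x.1] (h x.2))).2 fun a ↦ by
      refine exists_map_eq_of_pow_card_eq _ ?_
      rw [hK, Nat.card_eq_fintype_card, ← coeff_polyFrobenius_iterate, hper]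
    refine ⟨g, ⟨?_, ?_⟩, hg⟩
    · rw [← totalDegree_map_field (j : K →+* Ω), hg, hd]
    · rw [← MonomialOrder.monic_map_iff (j : K →+* Ω), hg]
      exact hm
  · rintro ⟨i, f⟩ ⟨i', f'⟩ hx
    have hx : τ^[i] (h f) = τ^[i'] (h f') := congrArg Subtype.val hx
    have hprod (i : Fin p) (f : splitRelativelyIrreducible m n p F) :
        orbitProd τ p (τ^[i] (h f)) = map (algebraMap F Ω) f.1 := by
      rw [← iterate_orbitProd, ← (hh f).2.2]
      exact Function.iterate_fixed (mapEquiv_map_algebraMap f.1) i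
    obtain rfl : f = f' := Subtype.ext (hinj (by rw [← hprod i f, ← hprod i' f', hx]))
    have := (Function.iterate_eq_iterate_iff_of_lt_minimalPeriod
      (i.2.trans_eq (hh f).2.1.symm) (i'.2.trans_eq (hh f).2.1.symm)).1 hx
    rw [Fin.ext this]

/-- Polynomials of degree below n/p are kept in the estimate, which makes the term p = ℓ equal to ε.
-/
lemma ncard_relativelyIrreducible_le (hr : 1 ≤ r) (hn : 2 ≤ n) :
    ((relativelyIrreducible m n F).ncard : ℝ) ≤ ∑ p ∈ n.primeFactors,
      ((Nat.card F : ℝ) ^ p) ^ ((r + n / p).choose r) / (p * ((Nat.card F : ℝ) ^ p - 1)) := by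
  have hfin (p : ℕ) : (splitRelativelyIrreducible m n p F).Finite :=
    (ncard_totalDegree_le hr n).2.subset fun _ hf ↦ hf.1.le
  have h1 : (relativelyIrreducible m n F).ncard ≤
      ∑ p ∈ n.primeFactors, (splitRelativelyIrreducible m n p F).ncard :=
    (Set.ncard_le_ncard (relativelyIrreducible_subset (by omega))
      (n.primeFactors.finite_toSet.biUnion fun p _ ↦ hfin p)).trans
      (Finset.set_ncard_biUnion_le _ _)
  refine (Nat.cast_le.2 h1).trans ?_
  rw [Nat.cast_sum]
  refine Finset.sum_le_sum fun p hp ↦ ?_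
  have hpp := Nat.prime_of_mem_primeFactors hp
  obtain ⟨K, _, _, _, hK⟩ := exists_finite_extension F hpp.pos
  have h2 := mul_ncard_splitRelativelyIrreducible_le (m := m) (n := n) hr hpp.pos hK
  have h3 := ncard_monicOfTotalDegree (K := K) m hr
    (Nat.div_pos (Nat.le_of_mem_primeFactors hp) hpp.pos)
  have hF : (1 : ℝ) < (Nat.card F : ℝ) ^ p :=
    one_lt_pow₀ (by exact_mod_cast Finite.one_lt_card (α := F)) hpp.ne_zero
  have hp0 : (0 : ℝ) < p := by exact_mod_cast hpp.pos
  have hK1 : 1 ≤ Nat.card F ^ p := Nat.one_le_pow _ _ Nat.card_pos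
  rw [hK] at h3
  have h4 : (Nat.card F ^ p - 1) * (p * (splitRelativelyIrreducible m n p F).ncard) ≤
      (Nat.card F ^ p) ^ ((r + n / p).choose r) := by
    rw [← h3]
    exact (Nat.mul_le_mul_left _ h2).trans (Nat.le_add_right _ _)
  rw [le_div_iff₀ (mul_pos hp0 (by linarith))]
  have h5 : ((((Nat.card F ^ p - 1) * (p * (splitRelativelyIrreducible m n p F).ncard) : ℕ)) : ℝ) ≤
      ((Nat.card F ^ p) ^ ((r + n / p).choose r) : ℕ) := Nat.cast_le.2 h4
  push_cast [hK1] at h5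
  linarith

end UpperBound

/-! ### Lower bound. -/

section LowerBound

open MvPolynomial

variable {r : ℕ} {F : Type*} [Field F] [Fintype F] {m : MonomialOrder (Fin r)}

/-- A monic polynomial is Frobenius-invariant and so defined over `F`, or reducible with a monic
factor of degree at most d/2, or of the wanted kind. -/
lemma monicOfTotalDegree_subset {K : Type*} [Field K] [Algebra F K] [Algebra.IsAlgebraic F K]
    {d : ℕ} (hd : 1 ≤ d) :
    monicOfTotalDegree m d K ⊆
      ({g | g ∈ monicOfTotalDegree m d K ∧ Irreducible g ∧ polyFrobenius r F K g ≠ g} ∪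
        ⋃ i ∈ Finset.Icc 1 (d / 2),
          (fun x : MvPolynomial (Fin r) K × MvPolynomial (Fin r) K ↦ x.1 * x.2) ''
            (monicOfTotalDegree m i K ×ˢ monicOfTotalDegree m (d - i) K)) ∪
      map (algebraMap F K) '' monicOfTotalDegree m d F := by
  intro g hg
  by_cases hfix : polyFrobenius r F K g = g
  · right
    obtain ⟨f, rfl⟩ := exists_map_eq_of_fixed (frobenius_fixed (F := F) (K := K)) hfix
    exact ⟨f, ⟨totalDegree_map_field (algebraMap F K) f ▸ hg.1,
      (MonomialOrder.monic_map_iff (algebraMap F K)).1 hg.2⟩, rfl⟩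
  left
  by_cases hirr : Irreducible g
  · exact Or.inl ⟨hg, hirr, hfix⟩
  right
  have hnu : ¬ IsUnit g := by
    rw [isUnit_iff_totalDegree_eq_zero, hg.1]
    omega
  obtain ⟨a, b, ha, hb, hab⟩ : ∃ a b, ¬ IsUnit a ∧ ¬ IsUnit b ∧ g = a * b := by
    by_contra! h
    refine hirr ⟨hnu, fun a b hab ↦ ?_⟩
    by_contra! hc
    exact h a b hc.1 hc.2 hab
  have ha0 : a ≠ 0 := by rintro rfl; exact hg.2.ne_zero (by simp [hab])
  have hb0 : b ≠ 0 := by rintro rfl; exact hg.2.ne_zero (by simp [hab])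
  obtain ⟨a', ham, haa⟩ := exists_monic_associated (m := m) ha0
  obtain ⟨b', hbm, hbb⟩ := exists_monic_associated (m := m) hb0
  have hgab : g = a' * b' := hg.2.eq_of_associated (ham.mul hbm) (hab ▸ haa.mul_mul hbb)
  have hda : a'.totalDegree ≠ 0 := fun h ↦
    ha (haa.isUnit_iff.2 (isUnit_iff_totalDegree_eq_zero.2 ⟨ham.ne_zero, h⟩))
  have hdb : b'.totalDegree ≠ 0 := fun h ↦
    hb (hbb.isUnit_iff.2 (isUnit_iff_totalDegree_eq_zero.2 ⟨hbm.ne_zero, h⟩))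
  have hdeg := hg.1
  rw [hgab, totalDegree_mul_of_isDomain ham.ne_zero hbm.ne_zero] at hdeg
  rcases le_total a'.totalDegree b'.totalDegree with h | h
  · exact Set.mem_biUnion (x := a'.totalDegree) (Finset.mem_coe.2 (Finset.mem_Icc.2 (by omega)))
      ⟨(a', b'), ⟨⟨rfl, ham⟩, ⟨by dsimp only; omega, hbm⟩⟩, hgab.symm⟩
  · exact Set.mem_biUnion (x := b'.totalDegree) (Finset.mem_coe.2 (Finset.mem_Icc.2 (by omega)))
      ⟨(b', a'), ⟨⟨rfl, hbm⟩, ⟨by dsimp only; omega, ham⟩⟩, (hgab.trans (mul_comm _ _)).symm⟩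

lemma ncard_monicOfTotalDegree_le {K : Type*} [Field K] [Finite K] [Algebra F K]
    [Algebra.IsAlgebraic F K] (hr : 1 ≤ r) {d : ℕ} (hd : 1 ≤ d) :
    (monicOfTotalDegree m d K).ncard ≤
      {g | g ∈ monicOfTotalDegree m d K ∧ Irreducible g ∧ polyFrobenius r F K g ≠ g}.ncard +
        ∑ i ∈ Finset.Icc 1 (d / 2),
          (monicOfTotalDegree m i K).ncard * (monicOfTotalDegree m (d - i) K).ncard +
        (monicOfTotalDegree m d F).ncard := by
  have hfin (i : ℕ) := finite_monicOfTotalDegree (K := K) m hr i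
  have hfinF := finite_monicOfTotalDegree (K := F) m hr d
  have hfinG : {g | g ∈ monicOfTotalDegree m d K ∧ Irreducible g ∧ polyFrobenius r F K g ≠ g}.Finite :=
    (hfin d).subset fun _ h ↦ h.1
  have hfinP (i : ℕ) := ((hfin i).prod (hfin (d - i))).image
    (fun x : MvPolynomial (Fin r) K × MvPolynomial (Fin r) K ↦ x.1 * x.2)
  refine (Set.ncard_le_ncard (monicOfTotalDegree_subset (F := F) hd)
    ((hfinG.union ((Finset.Icc 1 (d / 2)).finite_toSet.biUnion fun i _ ↦ hfinP i)).union
      (hfinF.image _))).trans ?_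
  refine (Set.ncard_union_le _ _).trans (add_le_add ((Set.ncard_union_le _ _).trans
    (add_le_add le_rfl ((Finset.set_ncard_biUnion_le _ _).trans
      (Finset.sum_le_sum fun i _ ↦ ?_)))) (Set.ncard_image_le hfinF))
  exact (Set.ncard_image_le ((hfin i).prod (hfin (d - i)))).trans_eq Set.ncard_prod

/-- Orbit products of irreducible polynomials over the extension of prime degree `l` are
relatively irreducible, and each one arises from at most `l` polynomials. -/
lemma ncard_irreducible_le {K : Type*} [Field K] [Finite K] [Algebra F K] {l d : ℕ}
    [Algebra.IsAlgebraic F K] (hK : Nat.card K = Nat.card F ^ l) (hl : l.Prime) (hr : 1 ≤ r)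
    (hd : 1 ≤ d) :
    {g | g ∈ monicOfTotalDegree m d K ∧ Irreducible g ∧ polyFrobenius r F K g ≠ g}.ncard ≤
      l * (relativelyIrreducible m (l * d) F).ncard := by
  classical
  let Ω := AlgebraicClosure F
  let j : K →ₐ[F] Ω := IsAlgClosed.lift
  let τ := polyFrobenius r F K
  have hτ (g : MvPolynomial (Fin r) K) : Function.IsPeriodicPt τ l g := by
    change τ^[l] g = g
    ext a
    have := Fintype.ofFinite K
    rw [coeff_polyFrobenius_iterate, ← Nat.card_eq_fintype_card, ← hK, Nat.card_eq_fintype_card,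
      FiniteField.pow_card]
  let E := relativelyIrreducible m (l * d) F
  have hE : E.Finite := finite_relativelyIrreducible hr
  have := hE.to_subtype
  let IsFactor (f : MvPolynomial (Fin r) F) (g : MvPolynomial (Fin r) K) : Prop :=
    Irreducible g ∧ m.Monic g ∧ g ∣ map (algebraMap F K) f
  -- One chosen factor per `f`; the default 0 only adds harmless elements to the covering range.
  let g₀ (f : E) : MvPolynomial (Fin r) K := if h : ∃ g, IsFactor f g then h.choose else 0
  have hsub : {g | g ∈ monicOfTotalDegree m d K ∧ Irreducible g ∧ τ g ≠ g} ⊆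
      Set.range (fun x : Fin l × E ↦ τ^[x.1] (g₀ x.2)) := by
    rintro g ⟨⟨hgd, hgm⟩, hg, hfix⟩
    have hper : Function.minimalPeriod τ g = l :=
      ((Nat.dvd_prime hl).1 (hτ g).minimalPeriod_dvd).resolve_left fun h ↦
        hfix (Function.minimalPeriod_eq_one_iff_isFixedPt.1 h)
    obtain ⟨f, hfm, hf, hfg⟩ := exists_irreducible_map_eq_orbitProd (F := F)
      (frobenius_fixed (F := F) (K := K)) hg hgm (hper.symm ▸ hl.pos)
    change map (algebraMap F K) f = orbitProd τ (Function.minimalPeriod τ g) g at hfg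
    rw [hper] at hfg
    have hgf : g ∣ map (algebraMap F K) f := hfg ▸ dvd_orbitProd τ hl.pos g
    have hfd : f.totalDegree = l * d := by
      rw [← totalDegree_map_field (algebraMap F K), hfg, totalDegree_orbitProd _ hgm, hgd]
    have hfE : f ∈ E := by
      refine ⟨⟨hfd, hfm, hf⟩, fun habs ↦ ?_⟩
      obtain ⟨c, hc⟩ := hgf
      have hc0 : c ≠ 0 := by
        rintro rfl
        rw [mul_zero] at hc
        exact ((MonomialOrder.monic_map_iff (m := m) (algebraMap F K)).2 hfm).ne_zero hc
      have hcd : g.totalDegree + c.totalDegree = l * d := by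
        rw [← totalDegree_mul_of_isDomain hgm.ne_zero hc0, ← hc, totalDegree_map_field, hfd]
      -- The cofactor has degree (l - 1)d > 0, so `g` is a proper factor over `K` and remains one
      -- over the closure.
      have hcu : ¬ IsUnit c := by
        rw [isUnit_iff_totalDegree_eq_zero]
        rintro ⟨-, h0⟩
        have := Nat.mul_le_mul_right d hl.two_le
        omega
      have h2 : map (algebraMap F Ω) f = map (j : K →+* Ω) g * map (j : K →+* Ω) c := by
        rw [← map_mul, ← hc, map_map, j.comp_algebraMap]
      rcases habs.isUnit_or_isUnit h2 with h | h
      · exact hg.not_isUnit ((isUnit_mvMap_iff _).1 h)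
      · exact hcu ((isUnit_mvMap_iff _).1 h)
    have hex : ∃ g, IsFactor f g := ⟨g, hg, hgm, hgf⟩
    have hg₀ : g₀ ⟨f, hfE⟩ = hex.choose := dif_pos hex
    obtain ⟨h1, h2, h3⟩ := hex.choose_spec
    rw [← hg₀] at h1 h2 h3
    have heq := map_eq_orbitProd (frobenius_fixed (F := F) (K := K)) hf hfm h1 h2 h3
      (minimalPeriod_polyFrobenius_pos _)
    -- `g` is prime, so it divides, hence equals, one of the at most l conjugates of the chosen
    -- factor.
    rw [heq, orbitProd, hg.prime.dvd_finsetProd_iff] at hgf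
    obtain ⟨i, hi, hdvd⟩ := hgf
    have hil : i < l := (Finset.mem_range.1 hi).trans_le ((hτ _).minimalPeriod_le hl.pos)
    exact ⟨(⟨i, hil⟩, ⟨f, hfE⟩), ((hgm.eq_of_associated (monic_iterate _ h2 i)
      (hg.associated_of_dvd (irreducible_iterate h1 i) hdvd))).symm⟩
  refine (Set.ncard_le_ncard hsub (Set.finite_range _)).trans ?_
  rw [← Nat.card_coe_set_eq]
  refine (Finite.card_range_le _).trans_eq ?_
  rw [Nat.card_prod, Nat.card_fin, Nat.card_coe_set_eq]

lemma le_ncard_relativelyIrreducible {n : ℕ} (hr : 2 ≤ r) (hn : 2 ≤ n) (hcomp : ¬ n.Prime) :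
    exceptionalEps r n (Nat.card F) *
      (1 - 3 * (Nat.card F : ℝ) ^ (-exceptionalKappa r n)) ≤ (relativelyIrreducible m n F).ncard := by
  have hlp := Nat.minFac_prime (by omega : n ≠ 1)
  have hq : 2 ≤ Nat.card F := Finite.one_lt_card
  obtain ⟨K, _, _, _, hK⟩ := exists_finite_extension F hlp.pos
  have : Module.Finite F K := Module.Finite.of_finite
  have hd : 1 ≤ n / n.minFac := Nat.div_pos (Nat.minFac_le (by omega)) hlp.pos
  have hF1 : 1 ≤ Nat.card F := Nat.card_pos
  have hK1 : 1 ≤ Nat.card F ^ n.minFac := Nat.one_le_pow _ _ Nat.card_pos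
  refine (eps_lower_bound hr hn hcomp hq (fun i ↦ (monicOfTotalDegree m i K).ncard)
    (monicOfTotalDegree m (n / n.minFac) F).ncard (fun i ↦ by positivity) (fun i hi ↦ ?_) ?_
    (by positivity)).trans ?_
  · have h := ncard_monicOfTotalDegree (K := K) m (by omega) hi
    rw [hK] at h
    have h' := congrArg (Nat.cast (R := ℝ)) h
    push_cast [hK1] at h'
    exact h'
  · have h : ((((Nat.card F - 1) * (monicOfTotalDegree m (n / n.minFac) F).ncard) : ℕ) : ℝ) ≤
        ((Nat.card F ^ (r + n / n.minFac).choose r : ℕ) : ℝ) :=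
      Nat.cast_le.2 ((Nat.le_add_right _ _).trans_eq
        (ncard_monicOfTotalDegree (K := F) m (by omega) hd))
    push_cast [hF1] at h
    exact h
  · have hl0 : (0 : ℝ) < n.minFac := by exact_mod_cast hlp.pos
    rw [div_le_iff₀ hl0]
    have h1 := ncard_monicOfTotalDegree_le (F := F) (K := K) (m := m) (by omega) hd
    have h2 := ncard_irreducible_le (F := F) (m := m) hK hlp (by omega) hd
    rw [Nat.mul_div_cancel' (Nat.minFac_dvd n)] at h2
    have h3 := h1.trans (Nat.add_le_add_right (Nat.add_le_add_right h2 _) _)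
    have h4 := (Nat.cast_le (α := ℝ)).2 h3
    push_cast at h4
    linarith

end LowerBound

/-! ### Assembly of the two bounds. -/

theorem theorem2p21 (r n q : ℕ) (hr : 2 ≤ r) (hn : 2 ≤ n) (hcomp : ¬ n.Prime)
    (F : Type*) [Field F] [Fintype F] (hq : Fintype.card F = q)
    (m : MonomialOrder (Fin r)) :
    |((relativelyIrreducible m n F).ncard : ℝ) - exceptionalEps r n q| ≤
      exceptionalEps r n q * (3 * (q : ℝ) ^ (-exceptionalKappa r n)) := by
  rw [← Nat.card_eq_fintype_card] at hq
  subst hq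
  have hq2 : 2 ≤ Nat.card F := Finite.one_lt_card
  have hmem : n.minFac ∈ n.primeFactors :=
    Nat.mem_primeFactors.2 ⟨Nat.minFac_prime (by omega), Nat.minFac_dvd n, by omega⟩
  have hlow := le_ncard_relativelyIrreducible (F := F) (m := m) hr hn hcomp
  have hup := ncard_relativelyIrreducible_le (F := F) (m := m) (by omega : 1 ≤ r) hn
  -- The ℓ-term is ε itself, so the upper error is only the tail over the other primes.
  rw [← Finset.add_sum_erase _ _ hmem, ← exceptionalEps_eq hq2 hn] at hup
  have htail := tail_sum_le hr hn hcomp hq2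
  rw [abs_le]
  constructor <;> linarith
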